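/- Let $p$ be a prime and let $G$ be a finite $p$-group of order $n\ge 3$. Let $\mathcal{G}(G)$ be the power graph of $G$: its vertex set is $G$, and two distinct elements $u,v\in G$ are adjacent if $v=u^{k}$ or $u=v^{k}$ for some positive integer $k$. Let $\lambda_1\ge\lambda_2\ge\dots\ge\lambda_n=0$ be the eigenvalues, counted with multiplicity, of the Laplacian matrix $L=D-A$ of $\mathcal{G}(G)$ (where $D$ is the diagonal matrix of vertex degrees and $A$ is the adjacency matrix). Then the following statements are equivalent: (i) the algebraic connectivity $\lambda_{n-1}$ of $\mathcal{G}(G)$ is equal to $1$; (ii) the multiplicity of $n$ as an eigenvalue of $L$ is one; (iii) $G$ is neither cyclic nor generalized quaternion. Here $G$ is called generalized quaternion if it is isomorphic to the dicyclic group $\langle a,b \mid a^{2m}=e,\ a^{m}=b^{2},\ ab=ba^{-1}\rangle$ of order $4m$ for some $m=2^{k}$ with $k\ge 1$. -/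

import Mathlib

/-- The power graph of a group `G`: the vertices are the elements of `G`, and distinct `u`, `v`
are adjacent if one of them is a positive power of the other. -/
def powerGraph (G : Type*) [Group G] : SimpleGraph G where
  Adj u v := u ≠ v ∧ ((∃ k : ℕ, 0 < k ∧ v = u ^ k) ∨ (∃ k : ℕ, 0 < k ∧ u = v ^ k))
  symm := ⟨fun _ _ h => ⟨h.1.symm, h.2.symm⟩⟩
  loopless := ⟨fun _ h => h.1 rfl⟩

/-- The algebraic connectivity of a finite graph with `n ≥ 2` vertices: if
`λ₁ ≥ λ₂ ≥ ⋯ ≥ λₙ = 0` are the eigenvalues of its Laplacian matrix, counted with multiplicity,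
it is `λₙ₋₁`. (`Matrix.IsHermitian.eigenvalues₀` lists the eigenvalues in non-increasing order,
starting with index `0`, so `λₙ₋₁` has index `n - 2`.) -/
noncomputable def algebraicConnectivity {V : Type*} [Fintype V] [DecidableEq V]
    (Γ : SimpleGraph V) [DecidableRel Γ.Adj] (hV : 2 ≤ Fintype.card V) : ℝ :=
  (Γ.isHermitian_lapMatrix ℝ).eigenvalues₀ ⟨Fintype.card V - 2, by omega⟩

/-- The multiplicity of the real number `μ` as a Laplacian eigenvalue of a finite graph, i.e. as a
root of the characteristic polynomial of the Laplacian matrix (`0` if `μ` is not an eigenvalue). -/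
noncomputable def laplacianMultiplicity {V : Type*} [Fintype V] [DecidableEq V]
    (Γ : SimpleGraph V) [DecidableRel Γ.Adj] (μ : ℝ) : ℕ :=
  (Γ.lapMatrix ℝ).charpoly.rootMultiplicity μ

/-- A group is generalized quaternion if it is isomorphic to the dicyclic group
`⟨a, b | a ^ (2 * m) = 1, a ^ m = b ^ 2, a * b = b * a⁻¹⟩` of order `4 * m`, where `m ≥ 2` is a
power of `2`. -/
def IsGeneralizedQuaternion (G : Type*) [Group G] : Prop :=
  ∃ k : ℕ, 1 ≤ k ∧ Nonempty (G ≃* QuaternionGroup (2 ^ k))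

/-! Everything depends on how many vertices are adjacent to all others; the identity always is. A
Laplacian eigenvector for an eigenvalue other than `0` and `n` sums to zero and vanishes at every
such vertex, so at its positive maximum each dominating vertex contributes the full maximal value to
`L x`. One dominating vertex thus gives `μ ≥ 1`, two exclude `μ = 1`. Moreover `L(Γ) + L(Γᶜ) = n I -
J`, so eigenvectors for `n` are sum-zero vectors in the kernel of the complement's Laplacian.

If the `p`-group has a unique subgroup of order `p`, its generator is a second dominating vertex:
the connectivity is not `1`, and `n` has two independent eigenvectors. Otherwise fix `z` of order
`p` and split the nonidentity elements by whether they generate a subgroup containing `z`. No edge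
joins the two parts, so a vector constant on each has eigenvalue `1`, while the complement is
connected off the identity, which makes `n` simple.

It remains to show that uniqueness means cyclic or generalized quaternion. A self-centralizing
normal abelian subgroup is cyclic, say `⟨a⟩`. Take `b` outside with `b ^ p` inside, acting by `a ↦ a
^ r`. Unless `p = 2` and `4 ∣ r + 1`, some `b * a ^ k` has trivial `p`-th power, contradicting
uniqueness. The remaining case forces inversion of `a`, index two and the dicyclic relations. -/

section LaplacianSpectrum

open Matrix Finset

namespace SimpleGraph

/-! ### Laplacian eigenvectors in the presence of dominating vertices. -/

section Laplacian

variable {V : Type*} [Fintype V] [DecidableEq V] (Γ : SimpleGraph V) [DecidableRel Γ.Adj]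

theorem lapMatrix_mulVec_eq_sum_ite (x : V → ℝ) (v : V) :
    (Γ.lapMatrix ℝ *ᵥ x) v = ∑ w, if Γ.Adj v w then x v - x w else 0 := by
  rw [lapMatrix_mulVec_apply, ← Finset.sum_filter, Finset.sum_sub_distrib, Finset.sum_const,
    ← card_neighborFinset_eq_degree, neighborFinset_eq_filter, nsmul_eq_mul]

theorem sum_lapMatrix_mulVec (x : V → ℝ) : ∑ v, (Γ.lapMatrix ℝ *ᵥ x) v = 0 := by
  have h : (fun _ => (1 : ℝ)) ⬝ᵥ (Γ.lapMatrix ℝ *ᵥ x) = 0 := by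
    rw [dotProduct_mulVec, ← mulVec_transpose, (Γ.isSymm_lapMatrix (R := ℝ)).eq,
      lapMatrix_mulVec_const_eq_zero, zero_dotProduct]
  simpa [dotProduct] using h

/-- Each pair of distinct vertices is an edge of exactly one of `Γ`, `Γᶜ`, so the Laplacians add up
to that of the complete graph. -/
theorem lapMatrix_mulVec_add_compl (x : V → ℝ) (v : V) :
    (Γ.lapMatrix ℝ *ᵥ x) v + (Γᶜ.lapMatrix ℝ *ᵥ x) v = Fintype.card V * x v - ∑ w, x w := by
  rw [lapMatrix_mulVec_eq_sum_ite, lapMatrix_mulVec_eq_sum_ite, ← Finset.sum_add_distrib]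
  have h : ∀ w, ((if Γ.Adj v w then x v - x w else 0) + if Γᶜ.Adj v w then x v - x w else 0)
      = x v - x w := by
    intro w
    by_cases hw : v = w
    · subst hw; simp
    · by_cases h : Γ.Adj v w <;> simp [h, hw]
  simp only [h, Finset.sum_sub_distrib, sum_const, card_univ, nsmul_eq_mul]

variable {Γ}

theorem sum_eq_zero_of_lapMatrix_mulVec {x : V → ℝ} {μ : ℝ} (hμ : μ ≠ 0)
    (hx : Γ.lapMatrix ℝ *ᵥ x = μ • x) : ∑ v, x v = 0 := by
  have h := Γ.sum_lapMatrix_mulVec x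
  rw [hx] at h
  simpa [← Finset.mul_sum, hμ] using h

/-- At a dominating vertex the Laplacian acts as on the complete graph. -/
theorem lapMatrix_mulVec_of_dominating {e : V} (he : ∀ v, v ≠ e → Γ.Adj e v) (x : V → ℝ) :
    (Γ.lapMatrix ℝ *ᵥ x) e = Fintype.card V * x e - ∑ w, x w := by
  rw [← lapMatrix_mulVec_add_compl Γ, lapMatrix_mulVec_eq_sum_ite Γᶜ,
    Finset.sum_eq_zero (s := univ), add_zero]
  intro w _
  rw [if_neg]
  rw [compl_adj]
  rintro ⟨h1, h2⟩
  exact h2 (he w h1.symm)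

theorem lapMatrix_mulVec_dominatingVector {e : V} (he : ∀ v, v ≠ e → Γ.Adj e v) :
    Γ.lapMatrix ℝ *ᵥ ((Fintype.card V : ℝ) • Pi.single e (1 : ℝ) - 1) =
      (Fintype.card V : ℝ) • ((Fintype.card V : ℝ) • Pi.single e (1 : ℝ) - 1) := by
  have hc : Γ.lapMatrix ℝ *ᵥ (1 : V → ℝ) = 0 := Γ.lapMatrix_mulVec_const_eq_zero
  rw [mulVec_sub, mulVec_smul, hc, sub_zero]
  congr 1
  ext v
  by_cases hv : v = e
  · subst hv
    rw [lapMatrix_mulVec_of_dominating he]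
    simp
  · rw [lapMatrix_mulVec_eq_sum_ite, Finset.sum_eq_single e]
    · simp [(he v hv).symm, hv]
    · intro w _ hw
      simp [hv, hw]
    · simp

/-- Since `x` sums to zero, the eigenvalue equation at `e` reads `μ * x e = n * x e`. -/
theorem dominating_apply_eq_zero {e : V} (he : ∀ v, v ≠ e → Γ.Adj e v) {x : V → ℝ} {μ : ℝ}
    (hμ : μ ≠ 0) (hμ' : μ ≠ Fintype.card V) (hx : Γ.lapMatrix ℝ *ᵥ x = μ • x) : x e = 0 := by
  have h := lapMatrix_mulVec_of_dominating he x
  rw [hx, sum_eq_zero_of_lapMatrix_mulVec hμ hx] at h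
  simp only [Pi.smul_apply, smul_eq_mul, sub_zero] at h
  exact (mul_eq_mul_right_iff.mp h).resolve_left hμ'

omit [DecidableEq V] in
/-- A nonzero vector with sum zero has a positive maximal entry. -/
theorem exists_pos_max {x : V → ℝ} (hx : x ≠ 0) (hs : ∑ v, x v = 0) :
    ∃ v, 0 < x v ∧ ∀ w, x w ≤ x v := by
  have hne : Nonempty V := by
    by_contra h
    rw [not_nonempty_iff] at h
    exact hx (Subsingleton.elim _ _)
  obtain ⟨v, hv⟩ := Finite.exists_max x
  refine ⟨v, ?_, hv⟩
  by_contra! h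
  apply hx
  ext w
  exact (Finset.sum_eq_zero_iff_of_nonpos fun w _ => (hv w).trans h).mp hs w (mem_univ w)

/-- At a maximum of `x`, the Laplacian is bounded below by the sum of the differences to any set
of neighbours. -/
theorem sum_le_lapMatrix_mulVec {x : V → ℝ} {v : V} (hv : ∀ w, x w ≤ x v) {s : Finset V}
    (hs : ∀ w ∈ s, Γ.Adj v w) : ∑ w ∈ s, (x v - x w) ≤ (Γ.lapMatrix ℝ *ᵥ x) v := by
  rw [lapMatrix_mulVec_eq_sum_ite, ← Finset.sum_filter]
  refine Finset.sum_le_sum_of_subset_of_nonneg ?_ fun w _ _ => sub_nonneg.mpr (hv w)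
  intro w hw
  simpa using hs w hw

theorem one_le_of_lapMatrix_mulVec {e : V} (he : ∀ v, v ≠ e → Γ.Adj e v) {x : V → ℝ} {μ : ℝ}
    (hx0 : x ≠ 0) (hμ : μ ≠ 0) (hx : Γ.lapMatrix ℝ *ᵥ x = μ • x) : 1 ≤ μ := by
  by_cases hn : μ = Fintype.card V
  · rw [hn]
    exact_mod_cast Fintype.card_pos_iff.mpr ⟨e⟩
  obtain ⟨v, hv0, hv⟩ := exists_pos_max hx0 (sum_eq_zero_of_lapMatrix_mulVec hμ hx)
  have hxe := dominating_apply_eq_zero he hμ hn hx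
  have hve : v ≠ e := by rintro rfl; exact hv0.ne' hxe
  have h := sum_le_lapMatrix_mulVec (Γ := Γ) hv (s := {e}) (by simpa using (he v hve).symm)
  rw [hx] at h
  simp only [sum_singleton, hxe, sub_zero, Pi.smul_apply, smul_eq_mul] at h
  nlinarith

theorem ne_one_of_two_dominating {e z : V} (hez : e ≠ z) (he : ∀ v, v ≠ e → Γ.Adj e v)
    (hz : ∀ v, v ≠ z → Γ.Adj z v) {x : V → ℝ} {μ : ℝ} (hx0 : x ≠ 0)
    (hx : Γ.lapMatrix ℝ *ᵥ x = μ • x) : μ ≠ 1 := by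
  rintro rfl
  have hn : (1 : ℝ) ≠ Fintype.card V := by
    have : 1 < Fintype.card V := Fintype.one_lt_card_iff.mpr ⟨e, z, hez⟩
    exact_mod_cast this.ne
  obtain ⟨v, hv0, hv⟩ := exists_pos_max hx0 (sum_eq_zero_of_lapMatrix_mulVec one_ne_zero hx)
  have hxe := dominating_apply_eq_zero he one_ne_zero hn hx
  have hxz := dominating_apply_eq_zero hz one_ne_zero hn hx
  have hve : v ≠ e := by rintro rfl; exact hv0.ne' hxe
  have hvz : v ≠ z := by rintro rfl; exact hv0.ne' hxz
  have h := sum_le_lapMatrix_mulVec (Γ := Γ) hv (s := {e, z})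
    (by simpa using ⟨(he v hve).symm, (hz v hvz).symm⟩)
  rw [hx, Finset.sum_pair hez] at h
  simp only [hxe, hxz, sub_zero, Pi.smul_apply, smul_eq_mul] at h
  linarith

/-- If `V \ {e}` splits into two nonempty parts without edges between them, then `1` is a
Laplacian eigenvalue. -/
theorem exists_lapMatrix_mulVec_eq_self {e : V} (he : ∀ v, v ≠ e → Γ.Adj e v) {S T : Finset V}
    (hS : S.Nonempty) (hT : T.Nonempty) (hST : Disjoint S T)
    (hcover : ∀ v, v ≠ e ↔ v ∈ S ∨ v ∈ T) (hno : ∀ s ∈ S, ∀ t ∈ T, ¬ Γ.Adj s t) :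
    ∃ x : V → ℝ, x ≠ 0 ∧ Γ.lapMatrix ℝ *ᵥ x = (1 : ℝ) • x := by
  have hSpos : (0 : ℝ) < #S := by exact_mod_cast hS.card_pos
  have hTpos : (0 : ℝ) < #T := by exact_mod_cast hT.card_pos
  -- The weights make the sum zero; off `e` only the edge to `e` contributes to `L x`.
  let x : V → ℝ := fun v => (if v ∈ S then (#T : ℝ) else 0) - (if v ∈ T then (#S : ℝ) else 0)
  have hxS : ∀ v ∈ S, x v = #T := fun v hv => by
    simp [x, hv, Finset.disjoint_left.mp hST hv]
  have hxT : ∀ v ∈ T, x v = -#S := fun v hv => by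
    simp [x, hv, Finset.disjoint_right.mp hST hv]
  have hxe : x e = 0 := by
    have := (hcover e).not.mp (by simp)
    rw [not_or] at this
    simp [x, this.1, this.2]
  have hsum : ∑ v, x v = 0 := by
    simp only [x, Finset.sum_sub_distrib, Finset.sum_ite_mem, univ_inter, sum_const, nsmul_eq_mul]
    ring
  refine ⟨x, ?_, ?_⟩
  · obtain ⟨s, hs⟩ := hS
    intro h
    have := hxS s hs
    rw [h, Pi.zero_apply] at this
    exact hTpos.ne this
  · ext v
    rw [one_smul]
    by_cases hv : v = e
    · subst hv
      rw [lapMatrix_mulVec_of_dominating he, hsum, hxe]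
      simp
    · rw [lapMatrix_mulVec_eq_sum_ite, Finset.sum_eq_single e]
      · simp [(he v hv).symm, hxe]
      · intro w _ hw
        by_cases hvw : Γ.Adj v w
        · rw [if_pos hvw]
          rcases (hcover v).mp hv with h1 | h1 <;> rcases (hcover w).mp hw with h2 | h2
          · rw [hxS v h1, hxS w h2, sub_self]
          · exact absurd hvw (hno v h1 w h2)
          · exact absurd hvw.symm (hno w h2 v h1)
          · rw [hxT v h1, hxT w h2, sub_self]
        · rw [if_neg hvw]
      · simp

/-- If `V \ {e}` splits into two nonempty parts without edges between them, then the eigenvectors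
for the eigenvalue `|V|` are the multiples of a single vector. -/
theorem eq_smul_of_lapMatrix_mulVec_card {e : V} {S T : Finset V}
    (hS : S.Nonempty) (hT : T.Nonempty) (hST : Disjoint S T)
    (hcover : ∀ v, v ≠ e ↔ v ∈ S ∨ v ∈ T) (hno : ∀ s ∈ S, ∀ t ∈ T, ¬ Γ.Adj s t) {x : V → ℝ}
    (hx : Γ.lapMatrix ℝ *ᵥ x = (Fintype.card V : ℝ) • x) :
    ∃ c : ℝ, x = c • ((Fintype.card V : ℝ) • Pi.single e (1 : ℝ) - 1) := by
  have hcard : (Fintype.card V : ℝ) ≠ 0 := by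
    exact_mod_cast (Fintype.card_pos_iff.mpr ⟨e⟩).ne'
  have hsum := sum_eq_zero_of_lapMatrix_mulVec hcard hx
  have hc : Γᶜ.lapMatrix ℝ *ᵥ x = 0 := by
    ext v
    have := lapMatrix_mulVec_add_compl Γ x v
    rw [hx, hsum] at this
    simpa using this
  rw [lapMatrix_mulVec_eq_zero_iff_forall_adj] at hc
  -- The complement contains every edge between `S` and `T`, so its kernel vectors are constant off
  -- `e`.
  have hst : ∀ s ∈ S, ∀ t ∈ T, x s = x t := fun s hs t ht => by
    refine hc s t ((compl_adj _ _ _).mpr ⟨?_, hno s hs t ht⟩)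
    rintro rfl
    exact Finset.disjoint_left.mp hST hs ht
  obtain ⟨s, hs⟩ := hS
  obtain ⟨t, ht⟩ := hT
  have hconst : ∀ v, v ≠ e → x v = x s := by
    intro v hv
    rcases (hcover v).mp hv with h | h
    · rw [hst v h t ht, hst s hs t ht]
    · exact (hst s hs v h).symm
  have hxe : x e = -((Fintype.card V : ℝ) - 1) * x s := by
    rw [← Finset.add_sum_erase _ _ (mem_univ e),
      Finset.sum_congr rfl (fun v hv => hconst v (ne_of_mem_erase hv)), sum_const,
      card_erase_of_mem (mem_univ e), nsmul_eq_mul, card_univ,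
      Nat.cast_sub (Fintype.card_pos_iff.mpr ⟨e⟩)] at hsum
    push_cast at hsum
    linarith
  refine ⟨-x s, ?_⟩
  ext v
  by_cases hv : v = e
  · subst hv
    simp [hxe]
    ring
  · simp [hconst v hv, hv]

theorem eq_smul_one_of_lapMatrix_mulVec_eq_zero {e : V} (he : ∀ v, v ≠ e → Γ.Adj e v) {x : V → ℝ}
    (hx : Γ.lapMatrix ℝ *ᵥ x = (0 : ℝ) • x) : ∃ c : ℝ, x = c • (1 : V → ℝ) := by
  rw [zero_smul, lapMatrix_mulVec_eq_zero_iff_forall_adj] at hx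
  refine ⟨x e, ?_⟩
  ext v
  by_cases hv : v = e
  · simp [hv]
  · simp [hx e v (he v hv)]

end Laplacian

end SimpleGraph

/-! ### Multiplicities and sorted eigenvalues of real symmetric matrices. -/

namespace Matrix.IsHermitian

variable {n : Type*} [Fintype n] [DecidableEq n] {A : Matrix n n ℝ} (hA : A.IsHermitian)

theorem rootMultiplicity_charpoly_eq_card (μ : ℝ) :
    A.charpoly.rootMultiplicity μ = #{i | hA.eigenvalues i = μ} := by
  rw [← Polynomial.count_roots, hA.roots_charpoly_eq_eigenvalues, Multiset.count_map,
    Finset.card_def, Finset.filter_val]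
  congr 1
  refine Multiset.filter_congr fun i _ => ?_
  simp [eq_comm]

theorem eigenvectorBasis_ofLp_ne_zero (i : n) : (hA.eigenvectorBasis i).ofLp ≠ 0 := by
  intro h
  exact hA.eigenvectorBasis.orthonormal.ne_zero i (by ext j; simpa using congrFun h j)

/-- If the eigenspace of `μ` is at most one-dimensional, then `μ` occurs at most once among the
eigenvalues. -/
theorem eigenvalues_index_unique {μ : ℝ} {v : n → ℝ}
    (hv : ∀ x : n → ℝ, A *ᵥ x = μ • x → ∃ c : ℝ, x = c • v) {i j : n}
    (hi : hA.eigenvalues i = μ) (hj : hA.eigenvalues j = μ) : i = j := by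
  by_contra hij
  have hi' := hA.mulVec_eigenvectorBasis i
  have hj' := hA.mulVec_eigenvectorBasis j
  rw [hi] at hi'
  rw [hj] at hj'
  obtain ⟨c, hc⟩ := hv _ hi'
  obtain ⟨d, hd⟩ := hv _ hj'
  have h0 := hA.eigenvectorBasis.orthonormal.2 hij
  beta_reduce at h0
  rw [EuclideanSpace.inner_eq_star_dotProduct, hc, hd] at h0
  simp only [star_trivial, smul_dotProduct, dotProduct_smul, smul_eq_mul, mul_eq_zero,
    dotProduct_self_eq_zero] at h0
  rcases h0 with h | h | h
  · exact hA.eigenvectorBasis_ofLp_ne_zero i (by rw [hc, h, zero_smul])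
  · exact hA.eigenvectorBasis_ofLp_ne_zero j (by rw [hd, h, zero_smul])
  · exact hA.eigenvectorBasis_ofLp_ne_zero i (by rw [hc, h, smul_zero])

theorem exists_eigenvalues_eq {μ : ℝ} {x : n → ℝ} (hx0 : x ≠ 0) (hx : A *ᵥ x = μ • x) :
    ∃ i, hA.eigenvalues i = μ := by
  have h : μ ∈ spectrum ℝ A := by
    rw [← Matrix.spectrum_toLin', ← Module.End.hasEigenvalue_iff_mem_spectrum]
    exact Module.End.hasEigenvalue_of_hasEigenvector
      (Module.End.hasEigenvector_iff.mpr ⟨Module.End.mem_eigenspace_iff.mpr (by simpa using hx), hx0⟩)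
  rw [hA.spectrum_real_eq_range_eigenvalues] at h
  exact h

theorem eigenvalues_equiv (k : Fin (Fintype.card n)) :
    hA.eigenvalues (Fintype.equivOfCardEq (Fintype.card_fin _) k) = hA.eigenvalues₀ k := by
  simp [eigenvalues]

theorem exists_mulVec_eq_eigenvalues₀ (k : Fin (Fintype.card n)) :
    ∃ x : n → ℝ, x ≠ 0 ∧ A *ᵥ x = hA.eigenvalues₀ k • x :=
  ⟨_, hA.eigenvectorBasis_ofLp_ne_zero _, by
    rw [← hA.eigenvalues_equiv k]; exact hA.mulVec_eigenvectorBasis _⟩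

end Matrix.IsHermitian

/-! ### Connectivity and multiplicity in the two graph-theoretic cases. -/

namespace SimpleGraph

variable {V : Type*} [Fintype V] [DecidableEq V] {Γ : SimpleGraph V} [DecidableRel Γ.Adj]

theorem algebraicConnectivity_ne_one_of_two_dominating (hV : 2 ≤ Fintype.card V) {e z : V}
    (hez : e ≠ z) (he : ∀ v, v ≠ e → Γ.Adj e v) (hz : ∀ v, v ≠ z → Γ.Adj z v) :
    algebraicConnectivity Γ hV ≠ 1 := by
  obtain ⟨x, hx0, hx⟩ := (Γ.isHermitian_lapMatrix ℝ).exists_mulVec_eq_eigenvalues₀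
    ⟨Fintype.card V - 2, by omega⟩
  exact ne_one_of_two_dominating hez he hz hx0 hx

theorem algebraicConnectivity_eq_one (hV : 2 ≤ Fintype.card V) {e : V}
    (he : ∀ v, v ≠ e → Γ.Adj e v) {S T : Finset V}
    (hS : S.Nonempty) (hT : T.Nonempty) (hST : Disjoint S T)
    (hcover : ∀ v, v ≠ e ↔ v ∈ S ∨ v ∈ T) (hno : ∀ s ∈ S, ∀ t ∈ T, ¬ Γ.Adj s t) :
    algebraicConnectivity Γ hV = 1 := by
  have hA := Γ.isHermitian_lapMatrix ℝ
  have hge : ∀ k, hA.eigenvalues₀ k ≠ 0 → 1 ≤ hA.eigenvalues₀ k := fun k hk => by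
    obtain ⟨x, hx0, hx⟩ := hA.exists_mulVec_eq_eigenvalues₀ k
    exact one_le_of_lapMatrix_mulVec he hx0 hk hx
  have huniq : ∀ k l, hA.eigenvalues₀ k = 0 → hA.eigenvalues₀ l = 0 → k = l := fun k l hk hl => by
    rw [← hA.eigenvalues_equiv] at hk hl
    exact (Equiv.injective _) (hA.eigenvalues_index_unique
      (fun x hx => eq_smul_one_of_lapMatrix_mulVec_eq_zero he hx) hk hl)
  have hex : ∀ μ : ℝ, (∃ x : V → ℝ, x ≠ 0 ∧ Γ.lapMatrix ℝ *ᵥ x = μ • x) →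
      ∃ k, hA.eigenvalues₀ k = μ := by
    rintro μ ⟨x, hx0, hx⟩
    obtain ⟨i, hi⟩ := hA.exists_eigenvalues_eq hx0 hx
    exact ⟨_, hi⟩
  obtain ⟨k, hk⟩ := hex 1 (exists_lapMatrix_mulVec_eq_self he hS hT hST hcover hno)
  obtain ⟨l, hl⟩ := hex 0 ⟨1, fun h => one_ne_zero (congrFun h e), by
    rw [zero_smul]; exact Γ.lapMatrix_mulVec_const_eq_zero⟩
  have hlast : hA.eigenvalues₀ ⟨Fintype.card V - 1, by omega⟩ = 0 := by
    by_contra h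
    have h1 := hge _ h
    have h2 := hA.eigenvalues₀_antitone (show l ≤ ⟨Fintype.card V - 1, by omega⟩ by
      rw [Fin.le_def]; have := l.2; simp only; omega)
    linarith
  have hk' : k ≤ ⟨Fintype.card V - 2, by omega⟩ := by
    rw [Fin.le_def]
    have hne : k ≠ ⟨Fintype.card V - 1, by omega⟩ := by
      rintro rfl
      rw [hlast] at hk
      exact zero_ne_one hk
    have hne' : (k : ℕ) ≠ Fintype.card V - 1 := fun h => hne (Fin.ext h)
    have := k.2
    simp only
    omega
  -- The eigenvalue `1` sits at or before index `n - 2`, giving `≤`; as `0` is simple and occupies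
  -- index `n - 1`, the entry at `n - 2` is nonzero, hence `≥ 1`.
  refine le_antisymm (hk ▸ hA.eigenvalues₀_antitone hk') (hge _ fun h => ?_)
  have := Fin.ext_iff.mp (huniq _ _ h hlast)
  simp only at this
  omega

theorem laplacianMultiplicity_card_eq_one {e : V}
    (he : ∀ v, v ≠ e → Γ.Adj e v) {S T : Finset V}
    (hS : S.Nonempty) (hT : T.Nonempty) (hST : Disjoint S T)
    (hcover : ∀ v, v ≠ e ↔ v ∈ S ∨ v ∈ T) (hno : ∀ s ∈ S, ∀ t ∈ T, ¬ Γ.Adj s t) :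
    laplacianMultiplicity Γ (Fintype.card V : ℝ) = 1 := by
  have hA := Γ.isHermitian_lapMatrix ℝ
  rw [laplacianMultiplicity, hA.rootMultiplicity_charpoly_eq_card, Finset.card_eq_one]
  obtain ⟨i, hi⟩ := hA.exists_eigenvalues_eq (fun h => by
    obtain ⟨s, hs⟩ := hS
    have h1 := congrFun h s
    simp [(hcover s).mpr (Or.inl hs)] at h1) (lapMatrix_mulVec_dominatingVector he)
  refine ⟨i, Finset.ext fun j => ?_⟩
  simp only [mem_filter, mem_univ, true_and, mem_singleton]
  refine ⟨fun hj => ?_, fun hj => hj ▸ hi⟩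
  exact hA.eigenvalues_index_unique
    (fun x hx => eq_smul_of_lapMatrix_mulVec_card hS hT hST hcover hno hx) hj hi

theorem laplacianMultiplicity_card_ne_one (hV : 3 ≤ Fintype.card V) {e z : V}
    (hez : e ≠ z) (he : ∀ v, v ≠ e → Γ.Adj e v) (hz : ∀ v, v ≠ z → Γ.Adj z v) :
    laplacianMultiplicity Γ (Fintype.card V : ℝ) ≠ 1 := by
  intro h
  have hle := LinearMap.finrank_eigenspace_le (Matrix.toLin' (Γ.lapMatrix ℝ)) (Fintype.card V : ℝ)
  rw [Matrix.charpoly_toLin', ← laplacianMultiplicity, h, finrank_le_one_iff] at hle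
  obtain ⟨⟨u, _⟩, hu⟩ := hle
  have key : ∀ w : V, (∀ v, v ≠ w → Γ.Adj w v) →
      ∃ c : ℝ, c • u = (Fintype.card V : ℝ) • Pi.single w (1 : ℝ) - 1 := by
    intro w hw
    obtain ⟨c, hc⟩ := hu ⟨_, Module.End.mem_eigenspace_iff.mpr
      (by simpa only [Matrix.toLin'_apply] using lapMatrix_mulVec_dominatingVector hw)⟩
    exact ⟨c, congrArg Subtype.val hc⟩
  obtain ⟨c, hc⟩ := key e he
  obtain ⟨d, hd⟩ := key z hz
  -- At a third vertex both vectors equal `-1`, so two multiples of one `u` would coincide; yet they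
  -- differ at `e`.
  obtain ⟨t, ht⟩ : ∃ t, t ∉ ({e, z} : Finset V) := by
    by_contra! h
    have := Finset.card_le_card (fun x _ => h x : (univ : Finset V) ⊆ {e, z})
    rw [card_univ, Finset.card_pair hez] at this
    omega
  simp only [mem_insert, mem_singleton, not_or] at ht
  have h1 := congrFun hc t
  have h2 := congrFun hd t
  have h3 := congrFun hc e
  have h4 := congrFun hd e
  simp [ht.1, ht.2, hez] at h1 h2 h3 h4
  have h5 : u t ≠ 0 := by rintro h; simp [h] at h1
  have hcd : c = d := mul_right_cancel₀ h5 (h1.trans h2.symm)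
  rw [hcd, h4] at h3
  have : (3 : ℝ) ≤ Fintype.card V := by exact_mod_cast hV
  linarith

end SimpleGraph

end LaplacianSpectrum

section PGroupsAndPowerGraphs

open Finset

/-- `G` has exactly one cyclic subgroup of order `p`. -/
def HasUniqueSubgroupOfOrder (p : ℕ) (G : Type*) [Group G] : Prop :=
  ∃ z : G, orderOf z = p ∧ ∀ w : G, orderOf w = p → w ∈ Subgroup.zpowers z

/-! ### Finite `p`-groups with a unique subgroup of order `p`. -/

section PGroup

variable {p : ℕ} [hp : Fact p.Prime] {G : Type*} [Group G]

theorem IsPGroup.exists_mem_center_of_normal [Finite G] (hG : IsPGroup p G) {N : Subgroup G}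
    [N.Normal] (hN : N ≠ ⊥) : ∃ x ∈ N, x ≠ 1 ∧ x ∈ Subgroup.center G := by
  have hdvd : p ∣ Nat.card N := by
    refine (hG.to_subgroup N).card_eq_or_dvd.resolve_left fun h => hN ?_
    exact N.eq_bot_of_card_eq h
  obtain ⟨b, hb, hne⟩ :=
    (hG.of_equiv ConjAct.toConjAct).exists_fixed_point_of_prime_dvd_card_of_fixed_point N hdvd
      (a := 1) (fun g => smul_one g)
  refine ⟨b, b.2, fun h => hne (Subtype.ext h.symm), ?_⟩
  rw [Subgroup.mem_center_iff]
  intro g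
  have := congrArg Subtype.val (hb (ConjAct.toConjAct g))
  rw [ConjAct.Subgroup.val_conj_smul, ConjAct.toConjAct_smul] at this
  exact mul_inv_eq_iff_eq_mul.mp this

/-- A finite `p`-group has a normal commutative subgroup that contains its centralizer. -/
theorem IsPGroup.exists_normal_centralizer_eq [Finite G] (hG : IsPGroup p G) :
    ∃ A : Subgroup G, A.Normal ∧ Subgroup.centralizer (A : Set G) = A := by
  obtain ⟨A, ⟨hAn, hAc⟩, hmax⟩ :=
    (Set.toFinite {A : Subgroup G | A.Normal ∧ A ≤ Subgroup.centralizer (A : Set G)}).exists_maximal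
      ⟨⊥, inferInstance, bot_le⟩
  refine ⟨A, hAn, le_antisymm ?_ hAc⟩
  by_contra hlt
  have hN : (Subgroup.centralizer (A : Set G)).map (QuotientGroup.mk' A) ≠ ⊥ := by
    rw [Ne, Subgroup.map_eq_bot_iff, QuotientGroup.ker_mk']
    exact hlt
  have : ((Subgroup.centralizer (A : Set G)).map (QuotientGroup.mk' A)).Normal :=
    Subgroup.Normal.map inferInstance _ (QuotientGroup.mk'_surjective A)
  obtain ⟨x, ⟨g, hgC, rfl⟩, hx1, hxc⟩ := (hG.to_quotient A).exists_mem_center_of_normal hN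
  -- `B = ⟨g⟩A` is normal because the image of `g` is central, and abelian because `g` centralizes
  -- `A`; this contradicts maximality of `A`.
  set B := (Subgroup.zpowers (QuotientGroup.mk' A g)).comap (QuotientGroup.mk' A) with hB
  have hZ : (Subgroup.zpowers (QuotientGroup.mk' A g)).Normal := by
    refine ⟨fun n hn h => ?_⟩
    have : n ∈ Subgroup.center (G ⧸ A) := (Subgroup.zpowers_le.mpr hxc) hn
    rw [Subgroup.mem_center_iff.mp this h, mul_inv_cancel_right]
    exact hn
  have hform : ∀ b ∈ B, ∃ k : ℤ, ∃ a ∈ A, b = g ^ k * a := by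
    intro b hb
    obtain ⟨k, hk⟩ := Subgroup.mem_zpowers_iff.mp (Subgroup.mem_comap.mp hb)
    refine ⟨k, (g ^ k)⁻¹ * b, ?_, by group⟩
    rw [← map_zpow] at hk
    exact QuotientGroup.eq.mp hk
  have hcomm : ∀ a ∈ A, Commute g a := fun a ha =>
    (Subgroup.mem_centralizer_iff.mp hgC a ha).symm
  have hBc : B ≤ Subgroup.centralizer (B : Set G) := by
    intro b hb
    rw [Subgroup.mem_centralizer_iff]
    intro c hc
    obtain ⟨k, a, ha, rfl⟩ := hform b hb
    obtain ⟨l, a', ha', rfl⟩ := hform c hc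
    have h1 : Commute a a' := (Subgroup.mem_centralizer_iff.mp (hAc ha) a' ha').symm
    have h2 : Commute (g ^ k) (g ^ l) := (Commute.refl g).zpow_zpow k l
    exact ((h2.mul_right ((hcomm a' ha').zpow_left k)).mul_left
      ((((hcomm a ha).zpow_left l).symm).mul_right h1)).symm
  have hAB : A ≤ B := by
    intro a ha
    have h1 : QuotientGroup.mk' A a = 1 := (QuotientGroup.eq_one_iff a).mpr ha
    rw [hB, Subgroup.mem_comap, h1]
    exact one_mem _
  have hgB : g ∈ B := Subgroup.mem_comap.mpr (Subgroup.mem_zpowers _)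
  have hgA : g ∈ A := hmax (y := B) ⟨hZ.comap _, hBc⟩ hAB hgB
  exact hx1 ((QuotientGroup.eq_one_iff g).mpr hgA)

omit hp in
theorem IsPGroup.exists_pow_notMem_pow_mem (hG : IsPGroup p G) {H : Subgroup G} {x : G}
    (hx : x ∉ H) : ∃ j : ℕ, x ^ p ^ j ∉ H ∧ x ^ p ^ (j + 1) ∈ H := by
  classical
  have hex : ∃ k, x ^ p ^ k ∈ H := by
    obtain ⟨k, hk⟩ := hG x
    exact ⟨k, hk ▸ one_mem H⟩
  have h0 : Nat.find hex ≠ 0 := fun h => hx (by simpa using (Nat.find_eq_zero hex).mp h)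
  refine ⟨Nat.find hex - 1, Nat.find_min hex (by omega), ?_⟩
  rw [Nat.sub_add_cancel (by omega)]
  exact Nat.find_spec hex

theorem IsPGroup.isCoprime_orderOf (hG : IsPGroup p G) (a : G) {s : ℤ} (hs : ¬ (p : ℤ) ∣ s) :
    IsCoprime s (orderOf a : ℤ) := by
  obtain ⟨m, hm⟩ := IsPGroup.iff_orderOf.mp hG a
  rw [hm]
  push_cast
  exact ((Nat.prime_iff_prime_int.mp hp.out).coprime_iff_not_dvd.mpr hs).symm.pow_right

theorem IsPGroup.mem_zpowers_zpow (hG : IsPGroup p G) (a : G) {s : ℤ} (hs : ¬ (p : ℤ) ∣ s) :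
    a ∈ Subgroup.zpowers (a ^ s) := by
  obtain ⟨u, v, huv⟩ := hG.isCoprime_orderOf a hs
  refine Subgroup.mem_zpowers_iff.mpr ⟨u, ?_⟩
  rw [← zpow_mul, show s * u = 1 - (orderOf a : ℤ) * v by linear_combination huv, zpow_sub, zpow_mul]
  simp

omit hp in
theorem zpow_mul_of_conj {a b : G} {r : ℤ} (h : a * b = b * a ^ r) (j : ℤ) :
    a ^ j * b = b * a ^ (r * j) := by
  have h' : SemiconjBy b (a ^ r) a := h.symm
  have := (h'.zpow_right j).eq
  rw [← zpow_mul] at this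
  exact this.symm

omit hp in
theorem zpow_mul_pow_of_conj {a b : G} {r : ℤ} (h : a * b = b * a ^ r) (n : ℕ) (j : ℤ) :
    a ^ j * b ^ n = b ^ n * a ^ (r ^ n * j) := by
  induction n generalizing j with
  | zero => simp
  | succ n ih =>
    rw [pow_succ, ← mul_assoc, ih, mul_assoc, zpow_mul_of_conj h, ← mul_assoc]
    ring_nf

omit hp in
theorem mul_zpow_pow_of_conj {a b : G} {r : ℤ} (h : a * b = b * a ^ r) (k : ℤ) (n : ℕ) :
    (b * a ^ k) ^ n = b ^ n * a ^ (k * ∑ i ∈ range n, r ^ i) := by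
  induction n with
  | zero => simp
  | succ n ih =>
    rw [pow_succ, ih, mul_assoc, ← mul_assoc (a ^ _) b, zpow_mul_of_conj h, geom_sum_succ,
      mul_assoc b, ← zpow_add, ← mul_assoc, ← pow_succ]
    ring_nf

/-- If `b` normalizes a cyclic subgroup `⟨a⟩` and `b ^ p` is a `p`-th power in it, then `b` can be
corrected by an element of `⟨a⟩` so that its `p`-th power is trivial. -/
theorem IsPGroup.exists_mul_zpow_pow_eq_one (hG : IsPGroup p G) {a b : G} {r s : ℤ}
    (h : a * b = b * a ^ r) (hb : b ^ p = a ^ s) (hs : (p : ℤ) ∣ s)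
    (hS : (p : ℤ) ∣ ∑ i ∈ range p, r ^ i) (hS' : ¬ (p : ℤ) ^ 2 ∣ ∑ i ∈ range p, r ^ i) :
    ∃ k : ℤ, (b * a ^ k) ^ p = 1 := by
  obtain ⟨s', rfl⟩ := hs
  obtain ⟨S', hS1⟩ := hS
  have hnd : ¬ (p : ℤ) ∣ S' := fun hd => hS' (by rw [hS1, sq]; exact mul_dvd_mul_left _ hd)
  obtain ⟨u, v, huv⟩ := hG.isCoprime_orderOf a hnd
  -- `u` inverts `S'` modulo the order of `a`, so the exponent `p * s' + k * p * S'` vanishes there.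
  refine ⟨-s' * u, ?_⟩
  rw [mul_zpow_pow_of_conj h, hb, hS1, ← zpow_add,
    show (p : ℤ) * s' + -s' * u * (p * S') = (orderOf a : ℤ) * (p * s' * v) by
      linear_combination (-(p : ℤ) * s') * huv, zpow_mul]
  simp

omit hp in
theorem mem_zpowers_of_commute {a g : G}
    (hc : Subgroup.centralizer (Subgroup.zpowers a : Set G) = Subgroup.zpowers a)
    (hg : Commute g a) : g ∈ Subgroup.zpowers a := by
  rw [← hc, Subgroup.mem_centralizer_iff]
  intro y hy
  obtain ⟨k, rfl⟩ := Subgroup.mem_zpowers_iff.mp hy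
  exact (hg.zpow_right k).symm.eq

omit hp in
theorem eq_of_orderOf_eq_two {w z : G} (hz : orderOf z = 2) (hw : orderOf w = 2)
    (hwz : w ∈ Subgroup.zpowers z) : w = z := by
  obtain ⟨k, rfl⟩ := Subgroup.mem_zpowers_iff.mp hwz
  have hz2 : z ^ (2 : ℤ) = 1 := by
    have := pow_orderOf_eq_one z
    rw [hz] at this
    exact_mod_cast this
  rcases Int.even_or_odd' k with ⟨l, rfl | rfl⟩
  · rw [zpow_mul, hz2, one_zpow, orderOf_one] at hw
    omega
  · rw [zpow_add, zpow_mul, hz2, one_zpow, one_mul, zpow_one]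

variable {z : G} (hz : orderOf z = p) (hzu : ∀ w : G, orderOf w = p → w ∈ Subgroup.zpowers z)

include hzu in
theorem mem_of_pow_eq_one {A : Subgroup G} (hzA : z ∈ A) {w : G} (hw : w ^ p = 1) : w ∈ A := by
  by_cases h1 : w = 1
  · exact h1 ▸ one_mem A
  · exact Subgroup.zpowers_le.mpr hzA (hzu w (orderOf_eq_prime hw h1))

include hz hzu in
theorem IsPGroup.mem_of_nontrivial [Finite G] (hG : IsPGroup p G) {A : Subgroup G} (hA : A ≠ ⊥) :
    z ∈ A := by
  have hdvd : p ∣ Nat.card A := by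
    refine (hG.to_subgroup A).card_eq_or_dvd.resolve_left fun h => hA ?_
    exact A.eq_bot_of_card_eq h
  obtain ⟨w, hw⟩ := exists_prime_orderOf_dvd_card' p hdvd
  rw [← Subgroup.orderOf_coe] at hw
  have hle : Subgroup.zpowers (w : G) ≤ Subgroup.zpowers z := Subgroup.zpowers_le.mpr (hzu w hw)
  have heq : Subgroup.zpowers (w : G) = Subgroup.zpowers z := by
    refine Subgroup.eq_of_le_of_card_ge hle ?_
    rw [Nat.card_zpowers, Nat.card_zpowers, hw, hz]
  have : z ∈ Subgroup.zpowers (w : G) := heq ▸ Subgroup.mem_zpowers z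
  exact Subgroup.zpowers_le.mpr w.2 this

include hz hzu in
/-- In a `p`-group with a unique subgroup of order `p`, commutative subgroups are cyclic. -/
theorem IsPGroup.exists_eq_zpowers [Finite G] (hG : IsPGroup p G) {A : Subgroup G}
    (hA : A ≤ Subgroup.centralizer (A : Set G)) : ∃ a, A = Subgroup.zpowers a := by
  obtain ⟨⟨a, ha⟩, hmax⟩ := Finite.exists_max (fun a : A => orderOf (a : G))
  refine ⟨a, le_antisymm ?_ (Subgroup.zpowers_le.mpr ha)⟩
  by_contra hlt
  obtain ⟨x, hxA, hx⟩ := SetLike.not_le_iff_exists.mp hlt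
  obtain ⟨j, hj1, hj2⟩ := hG.exists_pow_notMem_pow_mem hx
  set y := x ^ p ^ j with hy
  have hyA : y ∈ A := pow_mem hxA _
  rw [pow_succ, pow_mul, ← hy] at hj2
  obtain ⟨s, hs⟩ := Subgroup.mem_zpowers_iff.mp hj2
  have hcomm : a * y = y * a ^ (1 : ℤ) := by
    rw [zpow_one]
    exact Subgroup.mem_centralizer_iff.mp (hA hyA) a ha
  have hane : a ≠ 1 := by
    rintro rfl
    have h1 := hmax ⟨y, hyA⟩
    simp only [orderOf_one] at h1
    have h2 : y = 1 := by
      rw [← orderOf_eq_one_iff]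
      have := orderOf_pos y
      omega
    rw [h2] at hj1
    exact hj1 (one_mem _)
  have hza : z ∈ Subgroup.zpowers a := hG.mem_of_nontrivial hz hzu (by simpa using hane)
  -- If `p ∣ s`, correct `y` to have trivial `p`-th power; if not, `⟨a⟩ ≤ ⟨y⟩` and the maximal order
  -- of `a` gives equality.
  by_cases hps : (p : ℤ) ∣ s
  · obtain ⟨k, hk⟩ := hG.exists_mul_zpow_pow_eq_one hcomm hs.symm hps (by simp) (by
      simp only [one_pow, sum_const, card_range, nsmul_eq_mul, mul_one]
      intro hd
      have h1 : p ^ 2 ∣ p := by exact_mod_cast hd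
      have h2 := Nat.le_of_dvd hp.out.pos h1
      have h3 := hp.out.one_lt
      nlinarith)
    have := mem_of_pow_eq_one hzu hza hk
    exact hj1 ((Subgroup.mul_mem_cancel_right _ (Subgroup.zpow_mem_zpowers a k)).mp this)
  · have h1 := hG.mem_zpowers_zpow a hps
    rw [hs] at h1
    have h2 : Subgroup.zpowers a ≤ Subgroup.zpowers y :=
      Subgroup.zpowers_le.mpr (Subgroup.zpowers_le.mpr (pow_mem (Subgroup.mem_zpowers y) p) h1)
    have h3 := Subgroup.eq_of_le_of_card_ge h2 (by
      rw [Nat.card_zpowers, Nat.card_zpowers]; exact hmax ⟨y, hyA⟩)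
    exact hj1 (h3 ▸ Subgroup.mem_zpowers y)

theorem Int.dvd_sub_one_of_dvd_pow_sub_one {r : ℤ} (h : (p : ℤ) ∣ r ^ p - 1) :
    (p : ℤ) ∣ r - 1 := by
  rw [← ZMod.intCast_zmod_eq_zero_iff_dvd] at h ⊢
  push_cast at h ⊢
  rwa [ZMod.pow_card] at h

omit hp in
-- For odd `p` the sum is congruent to `p` modulo `p ^ 2`.
theorem sq_not_dvd_geom_sum (hp : p.Prime) (hp2 : p ≠ 2) {r : ℤ} (h : (p : ℤ) ∣ r - 1) :
    ¬ (p : ℤ) ^ 2 ∣ ∑ i ∈ range p, r ^ i := by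
  obtain ⟨t, ht⟩ := h
  have key := odd_sq_dvd_geom_sum₂_sub (R := ℤ) (p := p) 1 t (hp.odd_of_ne_two hp2)
  have hr : (1 : ℤ) + p * t = r := by linarith
  simp only [hr, one_pow, mul_one] at key
  intro hd
  have h1 : (p : ℤ) ^ 2 ∣ p := (dvd_sub_right hd).mp key
  have h2 : p ^ 2 ∣ p := by exact_mod_cast h1
  have h3 := Nat.le_of_dvd hp.pos h2
  have h4 := hp.one_lt
  nlinarith

include hz hzu in
/-- The key step: outside a self-centralizing cyclic normal subgroup `⟨a⟩`, the elements with
`p`-th power in it exist only for `p = 2`, and invert `a`. -/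
theorem IsPGroup.conj_eq_inv_of_pow_mem (hG : IsPGroup p G) {a b : G}
    (hn : (Subgroup.zpowers a).Normal)
    (hc : Subgroup.centralizer (Subgroup.zpowers a : Set G) = Subgroup.zpowers a)
    (hza : z ∈ Subgroup.zpowers a) (hb : b ∉ Subgroup.zpowers a)
    (hbp : b ^ p ∈ Subgroup.zpowers a) :
    p = 2 ∧ a * b = b * a⁻¹ ∧ orderOf (b ^ 2) = 2 := by
  obtain ⟨s, hs⟩ := Subgroup.mem_zpowers_iff.mp hbp
  obtain ⟨r, hr⟩ := Subgroup.mem_zpowers_iff.mp (hn.conj_mem' a (Subgroup.mem_zpowers a) b)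
  have h : a * b = b * a ^ r := by rw [hr]; group
  have hcent : ∀ g, Commute g a → g ∈ Subgroup.zpowers a := fun g hg =>
    mem_zpowers_of_commute hc hg
  have hno : ∀ k : ℤ, (b * a ^ k) ^ p ≠ 1 := fun k hk => hb
    ((Subgroup.mul_mem_cancel_right _ (Subgroup.zpow_mem_zpowers a k)).mp
      (mem_of_pow_eq_one hzu hza hk))
  -- Otherwise `a` is a power of `b ^ p`, so `b` commutes with `a`.
  have hps : (p : ℤ) ∣ s := by
    by_contra hps
    have h1 := hG.mem_zpowers_zpow a hps
    rw [hs] at h1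
    obtain ⟨k, hk⟩ := Subgroup.mem_zpowers_iff.mp h1
    refine hb (hcent b ?_)
    rw [← hk]
    exact ((Commute.refl b).pow_right p).zpow_right k
  obtain ⟨m, hm⟩ := IsPGroup.iff_orderOf.mp hG a
  have hane : a ≠ 1 := by
    rintro rfl
    exact hb (hcent b (Commute.one_right b))
  have hpa : (p : ℤ) ∣ orderOf a := by exact_mod_cast hG.dvd_orderOf hane
  have hrp : (orderOf a : ℤ) ∣ r ^ p - 1 := by
    rw [orderOf_dvd_iff_zpow_eq_one]
    have h1 := zpow_mul_pow_of_conj h p 1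
    rw [← hs, ← zpow_add, ← zpow_add] at h1
    have h2 : a ^ (r ^ p - 1) = a ^ (s + r ^ p * 1) * (a ^ (1 + s))⁻¹ := by
      rw [← zpow_neg, ← zpow_add]
      ring_nf
    rw [h2, h1, mul_inv_cancel]
  have hr1 := Int.dvd_sub_one_of_dvd_pow_sub_one (hpa.trans hrp)
  have hS : (p : ℤ) ∣ ∑ i ∈ range p, r ^ i := by
    have := dvd_geom_sum₂_self (R := ℤ) (n := p) (x := r) (y := 1) hr1
    simpa using this
  have hS' : (p : ℤ) ^ 2 ∣ ∑ i ∈ range p, r ^ i := by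
    by_contra hS'
    obtain ⟨k, hk⟩ := hG.exists_mul_zpow_pow_eq_one h hs.symm hps hS hS'
    exact hno k hk
  have hp2 : p = 2 := by
    by_contra hp2
    exact sq_not_dvd_geom_sum hp.out hp2 hr1 hS'
  subst hp2
  simp only [sum_range_succ, range_zero, sum_empty, pow_zero, zero_add, pow_one] at hS'
  -- Now `4 ∣ r + 1`, so `r - 1` is twice an odd number and cancelling it costs only one squaring.
  have hodd : ¬ ((2 : ℕ) : ℤ) ∣ (r - 1) / 2 := by omega
  have hfac : r - 1 = 2 * ((r - 1) / 2) := by omega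
  have hsmall : ∀ j : ℤ, (orderOf a : ℤ) ∣ j * (r - 1) → (a ^ j) ^ 2 = 1 := by
    intro j hj
    rw [hfac, ← mul_assoc] at hj
    have := (hG.isCoprime_orderOf a hodd).symm.dvd_of_dvd_mul_right hj
    rw [orderOf_dvd_iff_zpow_eq_one, zpow_mul] at this
    exact_mod_cast this
  have hb4 : (b ^ 2) ^ 2 = 1 := by
    rw [← hs]
    apply hsmall
    have h1 := zpow_mul_of_conj h s
    rw [hs, (Commute.pow_self b 2).eq, mul_right_inj, ← hs] at h1
    rw [orderOf_dvd_iff_zpow_eq_one]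
    have h2 : a ^ (s * (r - 1)) = a ^ (r * s) * (a ^ s)⁻¹ := by
      rw [← zpow_neg, ← zpow_add]
      ring_nf
    rw [h2, ← h1, mul_inv_cancel]
  have hb2 : b ^ 2 ≠ 1 := fun h1 => hno 0 (by simpa using h1)
  refine ⟨rfl, ?_, orderOf_eq_prime hb4 hb2⟩
  have har : (a ^ (r + 1)) ^ 2 = 1 := by
    apply hsmall
    convert! hrp using 1
    ring
  have huniq : ∀ w : G, w ^ 2 = 1 → w ≠ 1 → w = z := fun w hw hw1 =>
    eq_of_orderOf_eq_two hz (orderOf_eq_prime hw hw1) (hzu w (orderOf_eq_prime hw hw1))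
  by_cases h1 : a ^ (r + 1) = 1
  · rw [h]
    congr 1
    rw [zpow_add, zpow_one] at h1
    exact eq_inv_of_mul_eq_one_left h1
  -- Both `a ^ (r + 1)` and `b ^ 2` would be the unique involution, whence `(b * a) ^ 2 = b ^ 2 * a
  -- ^ (r + 1) = 1`.
  · exfalso
    refine hno 1 ?_
    rw [mul_zpow_pow_of_conj h]
    simp only [sum_range_succ, range_zero, sum_empty, pow_zero, zero_add, pow_one, one_mul]
    rw [add_comm, huniq _ har h1, ← huniq _ hb4 hb2, ← sq, hb4]

end PGroup

/-! ### Recognizing dicyclic groups and their involution. -/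

section Quaternion

variable {G : Type*} [Group G]

/-- A group with a cyclic subgroup `⟨a⟩` of order `2 * n` and index two, and `b ∉ ⟨a⟩` with
`b ^ 2 = a ^ n` which inverts `a`, is the dicyclic group. -/
theorem nonempty_mulEquiv_quaternionGroup {n : ℕ} {a b : G} (ha : orderOf a = 2 * n)
    (hab : a * b = b * a⁻¹) (hb : b ^ 2 = a ^ n) (hba : b ∉ Subgroup.zpowers a)
    (hcover : ∀ d, d ∈ Subgroup.zpowers a ∨ b⁻¹ * d ∈ Subgroup.zpowers a) :
    Nonempty (G ≃* QuaternionGroup n) := by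
  have h2n : a ^ (2 * n) = 1 := ha ▸ pow_orderOf_eq_one a
  let P : ZMod (2 * n) → G := fun i => (ZMod.lift (2 * n)
    ⟨zmultiplesHom (Additive G) (Additive.ofMul a), by
      rw [zmultiplesHom_apply, ← ofMul_zpow, zpow_natCast, h2n, ofMul_one]⟩ i).toMul
  have hP : ∀ k : ℤ, P k = a ^ k := fun k => by
    simp [P]
  have hPadd : ∀ i j, P (i + j) = P i * P j := fun i j => by simp [P]
  have hPb : ∀ i, P i * b = b * P (-i) := fun i => by
    obtain ⟨k, rfl⟩ := ZMod.intCast_surjective i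
    rw [← Int.cast_neg, hP, hP, zpow_mul_of_conj (r := -1) (by simpa using hab)]
    ring_nf
  have hPn : P n = b ^ 2 := by
    have := hP n
    rw [Int.cast_natCast, zpow_natCast] at this
    rw [this, hb]
  let f : QuaternionGroup n → G := fun
    | .a i => P i
    | .xa i => b * P i
  have hmul : ∀ x y, f (x * y) = f x * f y := by
    rintro (i | i) (j | j)
    · rw [QuaternionGroup.a_mul_a]
      exact hPadd i j
    · rw [QuaternionGroup.a_mul_xa]
      change b * P (j - i) = P i * (b * P j)
      rw [← mul_assoc, hPb, mul_assoc, ← hPadd, sub_eq_neg_add]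
    · rw [QuaternionGroup.xa_mul_a]
      change b * P (i + j) = b * P i * P j
      rw [hPadd, mul_assoc]
    · rw [QuaternionGroup.xa_mul_xa]
      change P (n + j - i) = b * P i * (b * P j)
      rw [mul_assoc, ← mul_assoc (P i), hPb, ← mul_assoc, ← mul_assoc, ← sq, ← hPn, ← hPadd,
        ← hPadd]
      ring_nf
  have hPmem : ∀ i, P i ∈ Subgroup.zpowers a := fun i => by
    obtain ⟨k, rfl⟩ := ZMod.intCast_surjective i
    rw [hP]
    exact Subgroup.zpow_mem_zpowers a k
  let F : QuaternionGroup n →* G := MonoidHom.mk' f hmul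
  have hinj : Function.Injective F := by
    rw [injective_iff_map_eq_one]
    rintro (i | i) hi
    · change P i = 1 at hi
      obtain ⟨k, rfl⟩ := ZMod.intCast_surjective i
      rw [hP, ← orderOf_dvd_iff_zpow_eq_one, ha] at hi
      rw [(ZMod.intCast_zmod_eq_zero_iff_dvd k (2 * n)).mpr hi, QuaternionGroup.a_zero]
    · change b * P i = 1 at hi
      exact absurd (eq_inv_of_mul_eq_one_left hi ▸ inv_mem (hPmem i)) hba
  have hsurj : Function.Surjective F := by
    intro d
    rcases hcover d with h | h
    · obtain ⟨k, rfl⟩ := Subgroup.mem_zpowers_iff.mp h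
      exact ⟨.a k, hP k⟩
    · obtain ⟨k, hk⟩ := Subgroup.mem_zpowers_iff.mp h
      refine ⟨.xa k, ?_⟩
      change b * P k = d
      rw [hP, hk, mul_inv_cancel_left]
  exact ⟨(MulEquiv.ofBijective F ⟨hinj, hsurj⟩).symm⟩

theorem QuaternionGroup.eq_a_of_orderOf_eq_two {n : ℕ} [NeZero n] {w : QuaternionGroup n}
    (hw : orderOf w = 2) : w = .a n := by
  rcases w with i | i
  · have h1 : (QuaternionGroup.a i) ^ 2 = 1 := hw ▸ pow_orderOf_eq_one _
    rw [sq, QuaternionGroup.a_mul_a, QuaternionGroup.one_def, QuaternionGroup.a.injEq] at h1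
    have h2 : i ≠ 0 := by
      rintro rfl
      rw [QuaternionGroup.a_zero, orderOf_one] at hw
      omega
    have hn : 0 < n := Nat.pos_of_ne_zero (NeZero.ne n)
    have h3 : ((i.val + i.val : ℕ) : ZMod (2 * n)) = 0 := by
      push_cast
      rw [ZMod.natCast_zmod_val, h1]
    rw [ZMod.natCast_eq_zero_iff] at h3
    obtain ⟨c, hc⟩ := h3
    have h4 := ZMod.val_lt i
    have h5 : i.val ≠ 0 := by rwa [Ne, ZMod.val_eq_zero]
    have hc1 : c = 1 := by
      have : c < 2 := by
        by_contra! h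
        nlinarith
      have : c ≠ 0 := by
        rintro rfl
        omega
      omega
    rw [QuaternionGroup.a.injEq, ← ZMod.natCast_zmod_val i]
    congr 1
    subst hc1
    omega
  · rw [QuaternionGroup.orderOf_xa] at hw
    omega

end Quaternion

/-! ### Cyclic or generalized quaternion. -/

section Classification

variable {p : ℕ} [hp : Fact p.Prime] {G : Type*} [Group G] [Finite G]

theorem IsPGroup.isCyclic_or_isGeneralizedQuaternion (hG : IsPGroup p G)
    (hU : HasUniqueSubgroupOfOrder p G) : IsCyclic G ∨ IsGeneralizedQuaternion G := by
  obtain ⟨z, hz, hzu⟩ := hU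
  obtain ⟨A, hn, hc⟩ := hG.exists_normal_centralizer_eq
  obtain ⟨a, rfl⟩ := hG.exists_eq_zpowers hz hzu hc.ge
  by_cases htop : ∀ g, g ∈ Subgroup.zpowers a
  · exact Or.inl ⟨a, htop⟩
  right
  push Not at htop
  have hz1 : z ≠ 1 := by
    rintro rfl
    rw [orderOf_one] at hz
    exact hp.out.one_lt.ne hz
  have hcent : ∀ g, Commute g a → g ∈ Subgroup.zpowers a := fun g hg =>
    mem_zpowers_of_commute hc hg
  have hane : a ≠ 1 := by
    rintro rfl
    exact hz1 (by simpa using hcent z (Commute.one_right z))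
  have hza : z ∈ Subgroup.zpowers a := hG.mem_of_nontrivial hz hzu (by simpa using hane)
  have key : ∀ b, b ∉ Subgroup.zpowers a → b ^ p ∈ Subgroup.zpowers a → _ := fun b hb hbp =>
    hG.conj_eq_inv_of_pow_mem hz hzu hn hc hza hb hbp
  obtain ⟨g, hg⟩ := htop
  obtain ⟨j, hj1, hj2⟩ := hG.exists_pow_notMem_pow_mem hg
  rw [pow_succ, pow_mul] at hj2
  obtain ⟨rfl, hab, hb2⟩ := key _ hj1 hj2
  set b := g ^ 2 ^ j with hbdef
  obtain ⟨m, hm⟩ := IsPGroup.iff_orderOf.mp hG a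
  have ha2 : a⁻¹ ≠ a := by
    intro h
    rw [h] at hab
    exact hj1 (hcent b hab.symm)
  have hm2 : 2 ≤ m := by
    by_contra! h
    have : a ^ 2 = 1 := by
      rw [← orderOf_dvd_iff_pow_eq_one, hm]
      exact (pow_dvd_pow 2 (by omega : m ≤ 1)).trans (by norm_num)
    rw [sq] at this
    exact ha2 (eq_inv_of_mul_eq_one_left this).symm
  have h4 : (4 : ℤ) ∣ orderOf a := by
    rw [hm]
    exact_mod_cast pow_dvd_pow 2 hm2
  -- Some `d ^ 2 ^ i` inverts `a`. If `i > 0`, a square would be `-1` modulo the order of `a`, hence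
  -- modulo `4`, which is impossible.
  have hinv : ∀ d, d ∉ Subgroup.zpowers a → a * d = d * a⁻¹ := by
    intro d hd
    obtain ⟨i, hi1, hi2⟩ := hG.exists_pow_notMem_pow_mem hd
    rw [pow_succ, pow_mul] at hi2
    obtain ⟨-, hi, -⟩ := key _ hi1 hi2
    rcases i with - | i
    · simpa using hi
    exfalso
    obtain ⟨r, hr⟩ := Subgroup.mem_zpowers_iff.mp (hn.conj_mem' a (Subgroup.mem_zpowers a) d)
    have h : a * d = d * a ^ r := by rw [hr]; group
    have h1 := zpow_mul_pow_of_conj h (2 ^ (i + 1)) 1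
    rw [zpow_one, hi, mul_right_inj, mul_one] at h1
    have h2 : (orderOf a : ℤ) ∣ r ^ 2 ^ (i + 1) + 1 := by
      rw [orderOf_dvd_iff_zpow_eq_one, zpow_add, ← h1, zpow_one, inv_mul_cancel]
    have h3 := h4.trans h2
    rw [pow_succ, pow_mul] at h3
    rcases Int.even_or_odd' (r ^ 2 ^ i) with ⟨l, hl | hl⟩ <;> rw [hl] at h3 <;> ring_nf at h3 <;>
      omega
  have hpow : orderOf a = 2 * 2 ^ (m - 1) := by
    rw [hm, ← pow_succ']
    congr 1
    omega
  refine ⟨m - 1, by omega, nonempty_mulEquiv_quaternionGroup hpow hab ?_ hj1 ?_⟩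
  · have huniq : ∀ w : G, orderOf w = 2 → w = z := fun w hw =>
      eq_of_orderOf_eq_two hz hw (hzu w hw)
    rw [huniq _ hb2, huniq (a ^ 2 ^ (m - 1))]
    have hdiv := orderOf_pow_of_dvd (x := a) (n := 2 ^ (m - 1)) (by positivity)
      (by rw [hpow]; exact dvd_mul_left _ _)
    rw [hdiv, hpow, Nat.mul_div_cancel _ (by positivity)]
  · intro d
    by_cases hd : d ∈ Subgroup.zpowers a
    · exact Or.inl hd
    · right
      -- Both `b` and `d` invert `a`, so `b⁻¹ * d` centralizes it.
      apply hcent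
      have h1 := hinv d hd
      have h2 : a⁻¹ * b = b * a := by
        have := zpow_mul_of_conj (a := a) (b := b) (r := -1) (by simpa using hab) (-1)
        simpa using this
      change b⁻¹ * d * a = a * (b⁻¹ * d)
      have h3 : a * b⁻¹ = b⁻¹ * a⁻¹ := by
        rw [eq_inv_mul_iff_mul_eq, ← mul_assoc, ← h2]
        group
      have h5 : a⁻¹ * d = d * a := by
        have := zpow_mul_of_conj (a := a) (b := d) (r := -1) (by simpa using h1) (-1)
        simpa using this
      rw [← mul_assoc, h3, mul_assoc, mul_assoc, h5]

omit hp in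
-- `⟨y⟩` already supplies the at most `orderOf y` solutions of `g ^ orderOf y = 1` in a cyclic
-- group.
theorem IsCyclic.mem_zpowers_of_orderOf_eq [IsCyclic G] {x y : G} (h : orderOf x = orderOf y) :
    x ∈ Subgroup.zpowers y := by
  classical
  have := Fintype.ofFinite G
  have h1 : (univ.filter fun g => g ∈ Subgroup.zpowers y) =
      univ.filter fun g : G => g ^ orderOf y = 1 := by
    refine Finset.eq_of_subset_of_card_le ?_ ?_
    · intro g hg
      simp only [mem_filter, mem_univ, true_and] at hg ⊢
      exact orderOf_dvd_iff_pow_eq_one.mp (orderOf_dvd_of_mem_zpowers hg)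
    · refine (IsCyclic.card_pow_eq_one_le (orderOf_pos y)).trans ?_
      rw [← Nat.card_zpowers, Nat.card_eq_fintype_card, Fintype.card_subtype]
  have h2 : x ∈ univ.filter fun g : G => g ^ orderOf y = 1 := by
    simp [← h, pow_orderOf_eq_one]
  rw [← h1] at h2
  simpa using h2

omit hp in
theorem mem_zpowers_of_orderOf_eq {s x y : G} (hx : x ∈ Subgroup.zpowers s)
    (hy : y ∈ Subgroup.zpowers s) (h : orderOf x = orderOf y) : x ∈ Subgroup.zpowers y := by
  have h1 : (⟨x, hx⟩ : Subgroup.zpowers s) ∈ Subgroup.zpowers ⟨y, hy⟩ :=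
    IsCyclic.mem_zpowers_of_orderOf_eq (by rwa [Subgroup.orderOf_mk, Subgroup.orderOf_mk])
  obtain ⟨k, hk⟩ := Subgroup.mem_zpowers_iff.mp h1
  exact Subgroup.mem_zpowers_iff.mpr ⟨k, congrArg Subtype.val hk⟩

theorem IsPGroup.hasUniqueSubgroupOfOrder_iff [Nontrivial G] (hG : IsPGroup p G) :
    HasUniqueSubgroupOfOrder p G ↔ IsCyclic G ∨ IsGeneralizedQuaternion G := by
  refine ⟨hG.isCyclic_or_isGeneralizedQuaternion, ?_⟩
  have hdvd : p ∣ Nat.card G :=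
    hG.card_eq_or_dvd.resolve_left (Finite.one_lt_card (α := G)).ne'
  obtain ⟨z, hz⟩ := exists_prime_orderOf_dvd_card' p hdvd
  rintro (h | ⟨k, -, ⟨e⟩⟩)
  · exact ⟨z, hz, fun w hw => IsCyclic.mem_zpowers_of_orderOf_eq (hw.trans hz.symm)⟩
  · have h4 : orderOf (e.symm (.xa 0)) = 4 := by
      rw [MulEquiv.orderOf_eq, QuaternionGroup.orderOf_xa]
    obtain ⟨j, hj⟩ := IsPGroup.iff_orderOf.mp hG (e.symm (.xa 0))
    have hp2 : p = 2 := by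
      have h2 : 2 ∣ p ^ j := by rw [← hj, h4]; norm_num
      exact ((Nat.prime_dvd_prime_iff_eq Nat.prime_two hp.out).mp
        (Nat.prime_two.dvd_of_dvd_pow h2)).symm
    subst hp2
    have huniq : ∀ w : G, orderOf w = 2 → e w = .a ((2 ^ k : ℕ) : ZMod (2 * 2 ^ k)) := fun w hw =>
      QuaternionGroup.eq_a_of_orderOf_eq_two (by rw [MulEquiv.orderOf_eq, hw])
    refine ⟨z, hz, fun w hw => ?_⟩
    rw [e.injective ((huniq w hw).trans (huniq z hz).symm)]
    exact Subgroup.mem_zpowers z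

end Classification

/-! ### Dominating vertices and separations of the power graph. -/

section PowerGraph

variable {G : Type*} [Group G]

theorem exists_pos_pow_eq_iff_mem_zpowers [Finite G] {u v : G} :
    (∃ k : ℕ, 0 < k ∧ v = u ^ k) ↔ v ∈ Subgroup.zpowers u := by
  refine ⟨fun ⟨k, _, hk⟩ => hk ▸ Subgroup.npow_mem_zpowers u k, fun h => ?_⟩
  obtain ⟨k, hk⟩ := mem_powers_iff_mem_zpowers.mpr h
  refine ⟨k + orderOf u, Nat.add_pos_right _ (orderOf_pos u), ?_⟩
  rw [pow_add, pow_orderOf_eq_one, mul_one]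
  exact hk.symm

theorem powerGraph_adj_iff [Finite G] {u v : G} : (powerGraph G).Adj u v ↔
    u ≠ v ∧ (v ∈ Subgroup.zpowers u ∨ u ∈ Subgroup.zpowers v) := by
  rw [← exists_pos_pow_eq_iff_mem_zpowers, ← exists_pos_pow_eq_iff_mem_zpowers]
  rfl

theorem powerGraph_adj_one [Finite G] {v : G} (hv : v ≠ 1) : (powerGraph G).Adj 1 v :=
  powerGraph_adj_iff.mpr ⟨hv.symm, Or.inr (one_mem _)⟩

variable {p : ℕ} [Fact p.Prime]

/-- A generator of the unique subgroup of order `p` is adjacent to all other elements. -/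
theorem IsPGroup.exists_dominating_of_hasUniqueSubgroupOfOrder [Finite G] (hG : IsPGroup p G)
    (hU : HasUniqueSubgroupOfOrder p G) :
    ∃ z : G, 1 ≠ z ∧ ∀ v, v ≠ z → (powerGraph G).Adj z v := by
  obtain ⟨z, hz, hzu⟩ := hU
  refine ⟨z, ?_, fun v hv => powerGraph_adj_iff.mpr ⟨hv.symm, ?_⟩⟩
  · rintro rfl
    rw [orderOf_one] at hz
    exact (Fact.out : p.Prime).one_lt.ne hz
  · by_cases h1 : v = 1
    · exact Or.inl (h1 ▸ one_mem _)
    · exact Or.inr (hG.mem_of_nontrivial hz hzu (by simpa using h1))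

/-- If there are several subgroups of order `p`, then the power graph without the identity is
disconnected. -/
theorem IsPGroup.exists_separation_of_not_hasUniqueSubgroupOfOrder [Fintype G] [Nontrivial G]
    (hG : IsPGroup p G) (hU : ¬ HasUniqueSubgroupOfOrder p G) :
    ∃ S T : Finset G, S.Nonempty ∧ T.Nonempty ∧ Disjoint S T ∧
      (∀ v, v ≠ 1 ↔ v ∈ S ∨ v ∈ T) ∧ ∀ s ∈ S, ∀ t ∈ T, ¬ (powerGraph G).Adj s t := by
  classical
  have hp : p.Prime := Fact.out
  have hdvd : p ∣ Nat.card G :=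
    hG.card_eq_or_dvd.resolve_left (Finite.one_lt_card (α := G)).ne'
  obtain ⟨z, hz⟩ := exists_prime_orderOf_dvd_card' p hdvd
  have hU' : ∃ w : G, orderOf w = p ∧ w ∉ Subgroup.zpowers z := by
    by_contra! h
    exact hU ⟨z, hz, h⟩
  obtain ⟨w, hw, hwz⟩ := hU'
  have hz1 : z ≠ 1 := by
    rintro rfl
    rw [orderOf_one] at hz
    exact hp.one_lt.ne hz
  refine ⟨univ.filter fun g => z ∈ Subgroup.zpowers g,
    univ.filter fun g => g ≠ 1 ∧ z ∉ Subgroup.zpowers g, ⟨z, by simp⟩, ⟨w, ?_⟩, ?_, ?_, ?_⟩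
  · simp only [mem_filter, mem_univ, true_and]
    refine ⟨?_, fun h => hwz ?_⟩
    · rintro rfl
      exact hwz (one_mem _)
    · exact mem_zpowers_of_orderOf_eq (Subgroup.mem_zpowers w) h (hw.trans hz.symm)
  · rw [Finset.disjoint_filter]
    exact fun g _ h1 h2 => h2.2 h1
  · intro v
    simp only [mem_filter, mem_univ, true_and]
    by_cases h : z ∈ Subgroup.zpowers v
    · simp only [h, not_true_eq_false, and_false, or_false, iff_true]
      rintro rfl
      exact hz1 (by simpa using h)
    · simp [h]
  · intro s hs t ht hadj
    simp only [mem_filter, mem_univ, true_and] at hs ht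
    rcases (powerGraph_adj_iff.mp hadj).2 with h | h
    -- An element of order `p` in `⟨t⟩` lies with `z` in the cyclic group `⟨s⟩`, so its powers
    -- include `z`.
    · have hpt : p ∣ Nat.card (Subgroup.zpowers t) := by
        rw [Nat.card_zpowers]
        exact hG.dvd_orderOf ht.1
      obtain ⟨y, hy⟩ := exists_prime_orderOf_dvd_card' p hpt
      rw [← Subgroup.orderOf_coe] at hy
      have hys : (y : G) ∈ Subgroup.zpowers s := Subgroup.zpowers_le.mpr h y.2
      exact ht.2 (Subgroup.zpowers_le.mpr y.2
        (mem_zpowers_of_orderOf_eq hs hys (hz.trans hy.symm)))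
    · exact ht.2 (Subgroup.zpowers_le.mpr h hs)

end PowerGraph

end PGroupsAndPowerGraphs

theorem mainTheorem2 (p : ℕ) (hp : p.Prime) (G : Type*) [Group G] [Fintype G] [DecidableEq G]
    [DecidableRel (powerGraph G).Adj] (hG : IsPGroup p G) (n : ℕ) (hcard : Fintype.card G = n)
    (hn : 3 ≤ n) :
    List.TFAE [
      algebraicConnectivity (powerGraph G) (by omega) = 1,
      laplacianMultiplicity (powerGraph G) (n : ℝ) = 1,
      ¬ IsCyclic G ∧ ¬ IsGeneralizedQuaternion G] := by
  subst hcard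
  have : Fact p.Prime := ⟨hp⟩
  have : Nontrivial G := Fintype.one_lt_card_iff_nontrivial.mp (by omega)
  have he : ∀ v : G, v ≠ 1 → (powerGraph G).Adj 1 v := fun v => powerGraph_adj_one
  rw [← not_or, ← hG.hasUniqueSubgroupOfOrder_iff]
  by_cases hU : HasUniqueSubgroupOfOrder p G
  · obtain ⟨z, hz1, hz⟩ := hG.exists_dominating_of_hasUniqueSubgroupOfOrder hU
    have h1 := SimpleGraph.algebraicConnectivity_ne_one_of_two_dominating (by omega) hz1 he hz
    have h2 := SimpleGraph.laplacianMultiplicity_card_ne_one hn hz1 he hz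
    simp [h1, h2, hU]
  · obtain ⟨S, T, hS, hT, hST, hcover, hno⟩ :=
      hG.exists_separation_of_not_hasUniqueSubgroupOfOrder hU
    have h1 := SimpleGraph.algebraicConnectivity_eq_one (by omega) he hS hT hST hcover hno
    have h2 := SimpleGraph.laplacianMultiplicity_card_eq_one he hS hT hST hcover hno
    simp [h1, h2, hU]
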